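/- Let $\alpha=(\alpha_1,\dots,\alpha_\ell)$ be a composition of $n$ (a finite sequence of positive integers with sum $n$). Its diagram consists of left-justified rows, the $i$-th row from the bottom having $\alpha_i$ cells. A semi-standard Young row-strict composition tableau (SSYRT) of shape $\alpha$ is a filling $T$ of the cells with positive integers, $T(i,c)$ denoting the entry in row $i$ (from the bottom) and column $c$ (from the left), such that (1) the entries in each row strictly increase from left to right; (2) the entries in the leftmost column weakly increase from bottom to top; (3) for all rows $i<j$ and all columns $c\ge 1$, if $T(j,c)<T(i,c+1)$ then $T(j,c+1)\le T(i,c+1)$, where every position outside the diagram is given the entry $\infty$. For $k\ge 0$ the Young row-strict quasisymmetric Schur function of $\alpha$ in $k$ variables is $$\mathcal R_\alpha(x_1,\dots,x_k)=\sum_T\ \prod_{\text{cells } (i,c)} x_{T(i,c)},$$ the sum being over all SSYRT $T$ of shape $\alpha$ with entries in $\{1,\dots,k\}$. Let $QSym_n(x_1,\dots,x_k)$ be the $\mathbb Z$-module of those polynomials in $\mathbb Z[x_1,\dots,x_k]$ that are homogeneous of degree $n$ and quasisymmetric, i.e. for every composition $(\beta_1,\dots,\beta_l)$ the coefficient of $x_{i_1}^{\beta_1}\cdots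 x_{i_l}^{\beta_l}$ is the same for all $1\le i_1<\dots<i_l\le k$. **Theorem.** For all integers $k\ge n\ge 0$, the polynomials $\mathcal R_\alpha(x_1,\dots,x_k)$, with $\alpha$ ranging over the compositions of $n$, form a $\mathbb Z$-basis of $QSym_n(x_1,\dots,x_k)$. -/

import Mathlib

noncomputable section

namespace YoungRowStrict

/-- The cells of the diagram of a composition `α`. A cell is a pair (row, column), both numbered
from `0`; row `i` has `α.blocksFun i` cells. Rows are numbered from bottom to top (French
convention) and columns from left to right. -/
abbrev Cell {n : ℕ} (α : Composition n) : Type :=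
  Σ i : Fin α.length, Fin (α.blocksFun i)

/-- A filling of the diagram of `α` with the labels `1, …, k`; the label `r + 1` is represented
by `r : Fin k`. -/
abbrev Filling {n : ℕ} (α : Composition n) (k : ℕ) : Type :=
  Cell α → Fin k

/-- The entry in row `i` and column `c`, where every position outside the diagram
has entry `∞`. -/
def entry {n k : ℕ} {α : Composition n} (T : Filling α k) (i : Fin α.length) (c : ℕ) :
    WithTop (Fin k) :=
  if h : c < α.blocksFun i then ((T ⟨i, ⟨c, h⟩⟩ : Fin k) : WithTop (Fin k)) else ⊤

/-- Semi-standard Young row-strict composition tableaux (SSYRT) of (non-skew) shape `α`. -/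
structure IsSSYRT {n k : ℕ} {α : Composition n} (T : Filling α k) : Prop where
  /-- Row entries strictly increase from left to right. -/
  row_strict : ∀ (i : Fin α.length) (c d : Fin (α.blocksFun i)), c < d → T ⟨i, c⟩ < T ⟨i, d⟩
  /-- Entries of the leftmost column weakly increase from bottom to top. -/
  first_column : ∀ i j : Fin α.length, i < j → entry T i 0 ≤ entry T j 0
  /-- The triple condition. It holds trivially (all `∞`) when column `c + 1` is beyond the
  largest part of `α`. -/
  triple : ∀ (i j : Fin α.length) (c : ℕ), i < j →
    entry T j c < entry T i (c + 1) → entry T j (c + 1) ≤ entry T i (c + 1)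

open scoped Classical in
/-- The Young row-strict quasisymmetric Schur function `R_α(x_1, …, x_k)`: the sum of the weights
`x^T` of all SSYRT `T` of shape `α` with labels in `{1, …, k}`. -/
def youngRowStrictSchur {n : ℕ} (k : ℕ) (α : Composition n) : MvPolynomial (Fin k) ℤ :=
  ∑ T : Filling α k with IsSSYRT T, ∏ c : Cell α, MvPolynomial.X (T c)

/-- The exponent vector of the monomial `x_{i_1}^{α_1} ⋯ x_{i_l}^{α_l}`, `i_1 < ⋯ < i_l`. -/
def exponent {d k : ℕ} (α : Composition d) (i : Fin α.length ↪o Fin k) : Fin k →₀ ℕ :=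
  ∑ s : Fin α.length, Finsupp.single (i s) (α.blocksFun s)

/-- A polynomial in `x_1, …, x_k` is quasisymmetric if for every composition `α` the monomials
`x_{i_1}^{α_1} ⋯ x_{i_l}^{α_l}` with `i_1 < ⋯ < i_l` all have the same coefficient. -/
def IsQuasisymmetric {k : ℕ} (f : MvPolynomial (Fin k) ℤ) : Prop :=
  ∀ (d : ℕ) (α : Composition d) (i j : Fin α.length ↪o Fin k),
    MvPolynomial.coeff (exponent α i) f = MvPolynomial.coeff (exponent α j) f

/-- `QSym_n(x_1, …, x_k)`: the `ℤ`-module of quasisymmetric polynomials in `x_1, …, x_k` with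
integer coefficients that are homogeneous of degree `n`. -/
def QSym (n k : ℕ) : Submodule ℤ (MvPolynomial (Fin k) ℤ) where
  carrier := {f | f.IsHomogeneous n ∧ IsQuasisymmetric f}
  zero_mem' := ⟨MvPolynomial.isHomogeneous_zero _ _ _, fun _ _ _ _ => by simp⟩
  add_mem' := fun {f g} hf hg => ⟨hf.1.add hg.1, fun d α i j => by
    rw [MvPolynomial.coeff_add, MvPolynomial.coeff_add, hf.2 d α i j, hg.2 d α i j]⟩
  smul_mem' := fun r f hf =>
    ⟨(MvPolynomial.homogeneousSubmodule (Fin k) ℤ n).smul_mem r hf.1, fun d α i j => by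
      rw [MvPolynomial.coeff_smul, MvPolynomial.coeff_smul, hf.2 d α i j]⟩

end YoungRowStrict

end

namespace YoungRowStrict

open MvPolynomial

variable {n k : ℕ} {α : Composition n}

/-! Standardization writes every SSYRT uniquely as a weakly increasing relabelling of a bijective
one `T`; the relabelling must rise strictly wherever the column index rises. Hence the coefficient
at a monomial of type `β` counts the standard `T` with `colSteps T ⊆ blockSteps β`
(`coeff_exponent_youngRowStrictSchur`): `R_α` is a sum of fundamental quasisymmetric functions, one
per `T`.

Each possible step set is `colSteps` of the row-by-row filling of exactly one `γ`, so the
coefficient matrix is `runMatrix * stepMatrix`. The second factor is, up to a permutation of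
columns, an inclusion matrix. The first is unitriangular for `colSum` (`colSum_lt_or_eq`): the
row-by-row filling has the smallest column indices its steps allow, and the triple rule leaves only
one tableau attaining them. The product is therefore invertible over `ℤ`. As `n ≤ k`, every `β`
labels a monomial, and these coefficients determine a quasisymmetric polynomial. -/

/-! ### Weights, and the tableau conditions without `∞` -/

/-- The weight of a filling, as the exponent vector of its monomial. -/
noncomputable def weight {X : Type*} [Fintype X] (f : X → Fin k) : Fin k →₀ ℕ :=
  ∑ x, Finsupp.single (f x) 1

open scoped Classical in
theorem coeff_youngRowStrictSchur (m : Fin k →₀ ℕ) :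
    coeff m (youngRowStrictSchur k α) =
      ((Finset.univ.filter fun f : Filling α k => IsSSYRT f ∧ weight f = m).card : ℤ) := by
  have h : ∀ f : Filling α k, ∏ c : Cell α, (X (f c) : MvPolynomial (Fin k) ℤ) =
      monomial (weight f) 1 := fun f => by
    rw [weight, monomial_sum_one]; rfl
  rw [youngRowStrictSchur, coeff_sum]
  simp only [h, coeff_monomial]
  rw [Finset.sum_boole, Finset.filter_filter]

/-- The value `∞` disappears: a finite upper bound in the triple rule forces the cell `(j, c + 1)`
to exist. -/
theorem isSSYRT_iff {f : Filling α k} :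
    IsSSYRT f ↔
      (∀ (i : Fin α.length) (c d : Fin (α.blocksFun i)), c < d → f ⟨i, c⟩ < f ⟨i, d⟩) ∧
      (∀ (i j : Fin α.length) (hi : 0 < α.blocksFun i) (hj : 0 < α.blocksFun j), i < j →
        f ⟨i, ⟨0, hi⟩⟩ ≤ f ⟨j, ⟨0, hj⟩⟩) ∧
      (∀ (i j : Fin α.length) (c : ℕ) (hj : c < α.blocksFun j) (hi : c + 1 < α.blocksFun i),
        i < j → f ⟨j, ⟨c, hj⟩⟩ < f ⟨i, ⟨c + 1, hi⟩⟩ →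
          ∃ h : c + 1 < α.blocksFun j, f ⟨j, ⟨c + 1, h⟩⟩ ≤ f ⟨i, ⟨c + 1, hi⟩⟩) := by
  constructor
  · intro H
    refine ⟨H.row_strict, fun i j hi hj hij => ?_, fun i j c hj hi hij hlt => ?_⟩
    · have := H.first_column i j hij
      simpa [entry, hi, hj] using this
    · have := H.triple i j c hij
      simp only [entry, hj, hi, dif_pos, WithTop.coe_lt_coe] at this
      have h2 := this hlt
      by_cases h : c + 1 < α.blocksFun j
      · exact ⟨h, by simpa [h] using h2⟩
      · simp [h] at h2
  · rintro ⟨h1, h2, h3⟩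
    refine ⟨h1, fun i j hij => ?_, fun i j c hij hlt => ?_⟩
    · have hi : 0 < α.blocksFun i := α.one_le_blocksFun i
      have hj : 0 < α.blocksFun j := α.one_le_blocksFun j
      simpa [entry, hi, hj] using h2 i j hi hj hij
    · by_cases hi : c + 1 < α.blocksFun i
      · by_cases hj : c < α.blocksFun j
        · simp only [entry, hj, hi, dif_pos, WithTop.coe_lt_coe] at hlt
          obtain ⟨h, hle⟩ := h3 i j c hj hi hij hlt
          simpa [entry, hi, h] using hle
        · simp [entry, hj] at hlt
      · simp [entry, hi]

/-- Two bijections onto `Fin n` that order their domain in the same way are equal. -/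
theorem equiv_eq_of_lt_imp_lt {X : Type*} {T T' : X ≃ Fin n}
    (h : ∀ x y, T x < T y → T' x < T' y) : T = T' := by
  have hm : StrictMono (T.symm.trans T') := fun a b hab => by
    simpa using h (T.symm a) (T.symm b) (by simpa using hab)
  have := Subsingleton.elim (hm.orderIsoOfSurjective _ (T.symm.trans T').surjective)
    (OrderIso.refl (Fin n))
  ext x
  have h2 := congrArg (fun e : Fin n ≃o Fin n => e (T x)) this
  simp at h2
  rw [h2]

theorem exists_equiv_lt_iff {X L : Type*} [Fintype X] [LinearOrder L] (hX : Fintype.card X = n)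
    (κ : X → L) (hκ : Function.Injective κ) : ∃ T : X ≃ Fin n, ∀ x y, T x < T y ↔ κ x < κ y := by
  let : LinearOrder X := LinearOrder.lift' κ hκ
  let e := Fintype.orderIsoFinOfCardEq X hX
  exact ⟨e.symm.toEquiv, fun x y => e.symm.lt_iff_lt⟩

theorem monotone_eq_of_weight_eq {w w' : Fin n → Fin k} (hw : Monotone w) (hw' : Monotone w')
    (h : weight w = weight w') : w = w' := by
  have h2 := congrArg Finsupp.toMultiset h
  simp only [weight, map_sum, Finsupp.toMultiset_single, one_smul] at h2
  have key : ∀ v : Fin n → Fin k, ∑ x, ({v x} : Multiset (Fin k)) = (List.ofFn v : Multiset _) := by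
    intro v
    rw [← List.sum_ofFn, ← Multiset.sum_map_singleton (↑(List.ofFn v) : Multiset (Fin k)), Multiset.map_coe,
      List.map_ofFn, Multiset.sum_coe]
    rfl
  rw [key, key, Multiset.coe_eq_coe] at h2
  have h3 := h2.eq_of_sortedLE (List.sortedLE_ofFn_iff.2 hw) (List.sortedLE_ofFn_iff.2 hw')
  exact List.ofFn_injective h3

theorem weight_comp_equiv {X Y : Type*} [Fintype X] [Fintype Y] (e : X ≃ Y) (f : Y → Fin k) :
    weight (f ∘ e) = weight f :=
  e.sum_comp fun y => Finsupp.single (f y) 1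

theorem sum_single_index {X : Type*} (β : Composition n) (φ : Fin β.length → X) :
    ∑ t, Finsupp.single (φ (β.index t)) 1 = ∑ s, Finsupp.single (φ s) (β.blocksFun s) := by
  rw [← β.blocksFinEquiv.sum_comp, Fintype.sum_sigma]
  refine Finset.sum_congr rfl fun s _ => ?_
  have : ∀ c : Fin (β.blocksFun s), β.index (β.blocksFinEquiv ⟨s, c⟩) = s := fun c =>
    β.index_embedding s c
  simp [this]

theorem weight_index (β : Composition n) (i : Fin β.length ↪o Fin k) :
    weight (i ∘ β.index) = exponent β i :=
  sum_single_index β i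

/-! ### Row-by-row numbering and step sets of compositions -/

theorem index_monotone (β : Composition n) : Monotone β.index := by
  intro s t hst
  by_contra! h
  have h1 := β.sizeUpTo_index_le s
  have h2 := β.lt_sizeUpTo_index_succ t
  have h3 := β.monotone_sizeUpTo (Nat.succ_le_of_lt h)
  have : (s : ℕ) ≤ t := hst
  simp only [Nat.succ_eq_add_one, Fin.val_succ] at *
  omega

/-- When the diagram is filled row by row with `0, …, n - 1`, the cell of `t + 1` is either the
right neighbour of the cell of `t` or the first cell of the next row. -/
theorem blocksFinEquiv_symm_succ (β : Composition n) (t : ℕ) (h : t + 1 < n) :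
    let x := β.blocksFinEquiv.symm ⟨t, by omega⟩
    let y := β.blocksFinEquiv.symm ⟨t + 1, h⟩
    (y.1 = x.1 ∧ (y.2 : ℕ) = x.2 + 1) ∨ ((y.1 : ℕ) = x.1 + 1 ∧ (y.2 : ℕ) = 0) := by
  intro x y
  have hx : β.sizeUpTo x.1 + x.2 = t := by
    have : β.blocksFinEquiv x = ⟨t, by omega⟩ := Equiv.apply_symm_apply _ _
    exact congrArg Fin.val this
  by_cases hc : (x.2 : ℕ) + 1 < β.blocksFun x.1
  · left
    have : y = ⟨x.1, ⟨x.2 + 1, hc⟩⟩ := by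
      rw [Equiv.symm_apply_eq]
      ext
      change t + 1 = β.sizeUpTo x.1 + (x.2 + 1)
      omega
    rw [this]; exact ⟨rfl, rfl⟩
  · right
    have hs : β.sizeUpTo (x.1 + 1) = t + 1 := by
      rw [β.sizeUpTo_succ' x.1]; have := x.2.2; omega
    have hl : (x.1 : ℕ) + 1 < β.length := by
      by_contra hl
      have : β.sizeUpTo (x.1 + 1) = n := β.sizeUpTo_ofLength_le _ (by omega)
      omega
    have : y = ⟨⟨x.1 + 1, hl⟩, ⟨0, β.one_le_blocksFun _⟩⟩ := by
      rw [Equiv.symm_apply_eq]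
      ext
      change t + 1 = β.sizeUpTo (x.1 + 1) + 0
      omega
    rw [this]; exact ⟨rfl, rfl⟩

theorem blocksFinEquiv_symm_zero (β : Composition n) (h : 0 < n) :
    let x := β.blocksFinEquiv.symm ⟨0, h⟩
    (x.1 : ℕ) = 0 ∧ (x.2 : ℕ) = 0 := by
  intro x
  have hl : 0 < β.length := β.length_pos_of_pos h
  have : x = ⟨⟨0, hl⟩, ⟨0, β.one_le_blocksFun _⟩⟩ := by
    rw [Equiv.symm_apply_eq]
    ext
    change 0 = β.sizeUpTo 0 + 0
    simp
  rw [this]; exact ⟨rfl, rfl⟩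

theorem eq_of_index_eq {β γ : Composition n}
    (h : ∀ t, (β.index t : ℕ) = γ.index t) : β = γ := by
  have h1 : ∀ (δ : Composition n) (i : ℕ),
      (∑ t, Finsupp.single (δ.index t : ℕ) 1) i = δ.blocks[i]?.getD 0 := by
    intro δ i
    rw [sum_single_index δ Fin.val, Finsupp.finsetSum_apply]
    by_cases hi : i < δ.length
    · rw [Finset.sum_eq_single ⟨i, hi⟩]
      · have : i < δ.blocks.length := hi
        simp [Composition.blocksFun, this]
      · intro b _ hb
        exact Finsupp.single_eq_of_ne (fun e => hb (Fin.ext e.symm))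
      · simp
    · rw [Finset.sum_eq_zero]
      · have : δ.blocks.length ≤ i := not_lt.1 hi
        simp [this]
      · intro b _
        exact Finsupp.single_eq_of_ne (fun e => hi (e ▸ b.2))
  have h2 : ∀ i : ℕ, β.blocks[i]?.getD 0 = γ.blocks[i]?.getD 0 := fun i => by
    rw [← h1, ← h1]; simp only [h]
  ext1
  apply List.ext_getElem?
  intro i
  -- Blocks are positive, so the default `0` occurs only past the end of the list.
  have h3 : ∀ (δ : Composition n), δ.blocks[i]? ≠ some 0 := fun δ e =>
    absurd (δ.blocks_pos (List.mem_of_getElem? e)) (lt_irrefl 0)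
  have h4 := h2 i
  have h5 := h3 β
  have h6 := h3 γ
  rcases hb : β.blocks[i]? with _ | a <;> rcases hg : γ.blocks[i]? with _ | b <;>
    simp_all

/-- The steps between consecutive blocks. -/
def blockSteps (β : Composition n) : Finset (Fin n) :=
  {t | ∃ h : (t : ℕ) + 1 < n, β.index t < β.index ⟨t + 1, h⟩}

/-- The block index starts at `0` and each step raises it by `0` or `1`; the set records which. -/
theorem blockSteps_injective : Function.Injective (blockSteps (n := n)) := by
  intro β γ h
  refine eq_of_index_eq fun t => ?_
  obtain ⟨t, ht⟩ := t
  induction t with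
  | zero =>
    exact (blocksFinEquiv_symm_zero β ht).1.trans (blocksFinEquiv_symm_zero γ ht).1.symm
  | succ t ih =>
    have ih := ih (by omega)
    have hb := blocksFinEquiv_symm_succ β t ht
    have hg := blocksFinEquiv_symm_succ γ t ht
    have hm := Finset.ext_iff.1 h ⟨t, by omega⟩
    simp only [blockSteps, Finset.mem_filter, Finset.mem_univ, true_and, ht, exists_true_left,
      Fin.lt_def] at hm
    change (β.index _ = β.index _ ∧ _) ∨ ((β.index _ : ℕ) = β.index _ + 1 ∧ _) at hb
    change (γ.index _ = γ.index _ ∧ _) ∨ ((γ.index _ : ℕ) = γ.index _ + 1 ∧ _) at hg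
    rw [Fin.ext_iff] at hb hg
    omega

/-! ### Standardization -/

/-- The key by which cells with equal entries are ordered: columns from right to left, the
leftmost column from bottom to top and the other columns from top to bottom. -/
def readingKey (x : Cell α) : ℕᵒᵈ ×ₗ ℤ :=
  toLex (OrderDual.toDual (x.2 : ℕ), if (x.2 : ℕ) = 0 then ((x.1 : ℕ) : ℤ) else -((x.1 : ℕ) : ℤ))

theorem cell_ext {x y : Cell α} (h : x.1 = y.1) (h2 : (x.2 : ℕ) = y.2) : x = y := by
  obtain ⟨i, c⟩ := x
  obtain ⟨j, d⟩ := y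
  dsimp only at h
  subst h
  exact congrArg (Sigma.mk i) (Fin.ext h2)

theorem readingKey_lt_iff {x y : Cell α} : readingKey x < readingKey y ↔
    (y.2 : ℕ) < x.2 ∨ ((x.2 : ℕ) = y.2 ∧ if (x.2 : ℕ) = 0 then x.1 < y.1 else y.1 < x.1) := by
  rw [readingKey, readingKey, Prod.Lex.toLex_lt_toLex]
  simp only [OrderDual.toDual_lt_toDual, OrderDual.toDual_inj]
  refine or_congr Iff.rfl (and_congr_right fun h => ?_)
  rw [h]
  split_ifs <;> rw [Fin.lt_def] <;> omega

theorem readingKey_injective : Function.Injective (readingKey (α := α)) := by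
  intro x y h
  have h1 : ¬ readingKey x < readingKey y := by rw [h]; exact lt_irrefl _
  have h2 : ¬ readingKey y < readingKey x := by rw [h]; exact lt_irrefl _
  rw [readingKey_lt_iff] at h1 h2
  have hc : (x.2 : ℕ) = y.2 := by omega
  refine cell_ext ?_ hc
  have h1 := fun h => h1 (Or.inr ⟨hc, h⟩)
  have h2 := fun h => h2 (Or.inr ⟨hc.symm, h⟩)
  rw [hc] at h1
  split_ifs at h1 h2
  exacts [le_antisymm (not_lt.1 h2) (not_lt.1 h1), le_antisymm (not_lt.1 h1) (not_lt.1 h2)]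

/-- The order in which the cells of a filling are numbered by its standardization. -/
def standardKey (f : Filling α k) (x : Cell α) : Fin k ×ₗ (ℕᵒᵈ ×ₗ ℤ) :=
  toLex (f x, readingKey x)

theorem standardKey_injective (f : Filling α k) : Function.Injective (standardKey f) := by
  intro x y h
  exact readingKey_injective (congrArg (fun z => (ofLex z).2) h)

theorem standardKey_lt_iff {f : Filling α k} {x y : Cell α} :
    standardKey f x < standardKey f y ↔ f x < f y ∨ (f x = f y ∧ readingKey x < readingKey y) := by
  rw [standardKey, standardKey, Prod.Lex.toLex_lt_toLex]

/-- The steps of a bijective filling at which the column index increases. -/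
def colSteps (T : Cell α ≃ Fin n) : Finset (Fin n) :=
  {t | ∃ h : (t : ℕ) + 1 < n, ((T.symm t).2 : ℕ) < (T.symm ⟨t + 1, h⟩).2}

theorem mem_blockSteps {β : Composition n} {t : ℕ} (h : t + 1 < n) :
    (⟨t, by omega⟩ : Fin n) ∈ blockSteps β ↔ β.index ⟨t, by omega⟩ < β.index ⟨t + 1, h⟩ := by
  simp [blockSteps, h]

theorem mem_colSteps {T : Cell α ≃ Fin n} {t : ℕ} (h : t + 1 < n) :
    (⟨t, by omega⟩ : Fin n) ∈ colSteps T ↔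
      ((T.symm ⟨t, by omega⟩).2 : ℕ) < (T.symm ⟨t + 1, h⟩).2 := by
  simp [colSteps, h]

theorem colSteps_subset_iff {T : Cell α ≃ Fin n} {β : Composition n} :
    colSteps T ⊆ blockSteps β ↔ ∀ (t : ℕ) (h : t + 1 < n),
      ((T.symm ⟨t, by omega⟩).2 : ℕ) < (T.symm ⟨t + 1, h⟩).2 →
        β.index ⟨t, by omega⟩ < β.index ⟨t + 1, h⟩ := by
  constructor
  · intro H t h hlt
    exact (mem_blockSteps h).1 (H ((mem_colSteps h).2 hlt))
  · rintro H ⟨t, ht⟩ hm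
    have h : t + 1 < n := by
      simp only [colSteps, Finset.mem_filter] at hm
      exact hm.2.1
    exact (mem_blockSteps h).2 (H t h ((mem_colSteps h).1 hm))

theorem IsSSYRT.lt_of_col_lt {T : Filling α k} (hT : IsSSYRT T) {x y : Cell α} (h : x.1 = y.1)
    (h2 : (x.2 : ℕ) < y.2) : T x < T y := by
  obtain ⟨i, c⟩ := x
  obtain ⟨j, d⟩ := y
  dsimp only at h
  subst h
  exact hT.row_strict _ _ _ h2

/-- On a stretch where the labels agree, the column indices weakly decrease. -/
theorem col_antitone {T : Cell α ≃ Fin n} {w : Fin n → Fin k} (hw : Monotone w)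
    (hD : ∀ (t : ℕ) (h : t + 1 < n),
      ((T.symm ⟨t, by omega⟩).2 : ℕ) < (T.symm ⟨t + 1, h⟩).2 → w ⟨t, by omega⟩ < w ⟨t + 1, h⟩)
    {x y : Cell α} (hxy : T x ≤ T y) (he : w (T x) = w (T y)) : (y.2 : ℕ) ≤ x.2 := by
  have key : ∀ (s t : ℕ) (hs : s < n) (ht : t < n), s ≤ t → w ⟨s, hs⟩ = w ⟨t, ht⟩ →
      ((T.symm ⟨t, ht⟩).2 : ℕ) ≤ (T.symm ⟨s, hs⟩).2 := by
    intro s t hs ht hst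
    induction t, hst using Nat.le_induction with
    | base => intro _; exact le_rfl
    | succ t hst ih =>
      intro hw2
      have ht' : t < n := by omega
      have h1 : w ⟨s, hs⟩ ≤ w ⟨t, ht'⟩ := hw hst
      have h2 : w ⟨t, ht'⟩ ≤ w ⟨t + 1, ht⟩ := hw (Nat.le_succ t)
      have h3 : w ⟨s, hs⟩ = w ⟨t, ht'⟩ := le_antisymm h1 (hw2 ▸ h2)
      refine le_trans ?_ (ih ht' h3)
      by_contra! h4
      exact (hD t ht h4).ne (h3 ▸ hw2)
  have := key (T x) (T y) (T x).2 (T y).2 hxy he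
  rwa [Fin.eta, Fin.eta, Equiv.symm_apply_apply, Equiv.symm_apply_apply] at this

/-- This gives uniqueness of standardization: the relabelled filling alone recovers the order of
`T`. -/
theorem standardKey_lt_of_lt {T : Cell α ≃ Fin n} (hT : IsSSYRT (k := n) T) {w : Fin n → Fin k}
    (hw : Monotone w)
    (hD : ∀ (t : ℕ) (h : t + 1 < n),
      ((T.symm ⟨t, by omega⟩).2 : ℕ) < (T.symm ⟨t + 1, h⟩).2 → w ⟨t, by omega⟩ < w ⟨t + 1, h⟩)
    {x y : Cell α} (hxy : T x < T y) : standardKey (w ∘ T) x < standardKey (w ∘ T) y := by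
  rw [standardKey_lt_iff]
  rcases (hw hxy.le).lt_or_eq with h | he
  · exact Or.inl h
  refine Or.inr ⟨he, readingKey_lt_iff.2 ?_⟩
  rcases (col_antitone hw hD hxy.le he).lt_or_eq with h | hc
  · exact Or.inl h
  refine Or.inr ⟨hc.symm, ?_⟩
  obtain ⟨-, hf, ht⟩ := isSSYRT_iff.1 hT
  obtain ⟨i, c, hci⟩ := x
  obtain ⟨j, d, hdj⟩ := y
  simp only at hc ⊢
  subst hc
  have hne : i ≠ j := by
    rintro rfl
    exact lt_irrefl _ hxy
  split_ifs with h0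
  · subst h0
    refine lt_of_le_of_ne (le_of_not_gt fun hji => ?_) hne
    exact absurd (hf j i hdj hci hji) (not_le.2 hxy)
  · refine lt_of_le_of_ne (le_of_not_gt fun hij => ?_) hne.symm
    -- Suppose the lower row `i` came first. The triple rule excludes `T (j, c) < T (i, c + 1)`.
    -- Otherwise `T (j, c)` lies in the stretch of equal labels ending at `T (j, c + 1)`, where
    -- columns cannot increase.
    obtain ⟨c, rfl⟩ := Nat.exists_eq_succ_of_ne_zero h0
    have hcj : c < α.blocksFun j := by omega
    have hlt : T ⟨j, ⟨c, hcj⟩⟩ < T ⟨j, ⟨c + 1, hdj⟩⟩ :=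
      hT.lt_of_col_lt rfl (Nat.lt_succ_self c)
    rcases lt_or_ge (T ⟨j, ⟨c, hcj⟩⟩) (T ⟨i, ⟨c + 1, hci⟩⟩) with h | h
    · obtain ⟨_, h2⟩ := ht i j c hcj hci hij h
      exact absurd h2 (not_le.2 hxy)
    · have h3 : w (T ⟨j, ⟨c, hcj⟩⟩) = w (T ⟨j, ⟨c + 1, hdj⟩⟩) :=
        le_antisymm (hw hlt.le) (he ▸ hw h)
      have := col_antitone hw hD hlt.le h3
      simp at this

theorem IsSSYRT.comp {T : Cell α ≃ Fin n} (hT : IsSSYRT (k := n) T) {w : Fin n → Fin k}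
    (hw : Monotone w)
    (hD : ∀ (t : ℕ) (h : t + 1 < n),
      ((T.symm ⟨t, by omega⟩).2 : ℕ) < (T.symm ⟨t + 1, h⟩).2 → w ⟨t, by omega⟩ < w ⟨t + 1, h⟩) :
    IsSSYRT (w ∘ T) := by
  obtain ⟨hr, hf, ht⟩ := isSSYRT_iff.1 hT
  refine isSSYRT_iff.2 ⟨fun i c d hcd => ?_, fun i j hi hj hij => hw (hf i j hi hj hij),
    fun i j c hj hi hij hlt => ?_⟩
  · refine lt_of_le_of_ne (hw (hr i c d hcd).le) fun he => ?_
    exact absurd (col_antitone hw hD (hr i c d hcd).le he) (not_le.2 hcd)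
  · obtain ⟨h, hle⟩ := ht i j c hj hi hij (hw.reflect_lt hlt)
    exact ⟨h, hw hle⟩

/-- Every SSYRT is obtained from a standard one by a weakly increasing relabelling. -/
theorem IsSSYRT.exists_standardization {f : Filling α k} (hf : IsSSYRT f) :
    ∃ (T : Cell α ≃ Fin n) (w : Fin n → Fin k), IsSSYRT (k := n) T ∧ Monotone w ∧
      (∀ (t : ℕ) (h : t + 1 < n),
        ((T.symm ⟨t, by omega⟩).2 : ℕ) < (T.symm ⟨t + 1, h⟩).2 →
          w ⟨t, by omega⟩ < w ⟨t + 1, h⟩) ∧ w ∘ T = f := by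
  obtain ⟨T, hT⟩ := exists_equiv_lt_iff
    ((Fintype.card_congr α.blocksFinEquiv).trans (Fintype.card_fin n)) (standardKey f)
    (standardKey_injective f)
  simp only [standardKey_lt_iff] at hT
  obtain ⟨hr, hc, ht⟩ := isSSYRT_iff.1 hf
  have hw : Monotone (f ∘ T.symm) := by
    refine monotone_iff_forall_lt.2 fun a b hab => ?_
    rcases (hT (T.symm a) (T.symm b)).1 (by simpa using hab) with h | h
    exacts [h.le, h.1.le]
  refine ⟨T, f ∘ T.symm, isSSYRT_iff.2 ⟨fun i c d hcd => (hT _ _).2 (Or.inl (hr i c d hcd)),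
    fun i j hi hj hij => ?_, fun i j c hj hi hij hlt => ?_⟩, hw, fun t h hcol => ?_, ?_⟩
  · refine ((hT _ _).2 ?_).le
    rcases (hc i j hi hj hij).lt_or_eq with h | h
    · exact Or.inl h
    · exact Or.inr ⟨h, readingKey_lt_iff.2 (Or.inr ⟨rfl, by simpa using hij⟩)⟩
  -- A tie is impossible: among equal entries, column `c + 1` is numbered before column `c`.
  · have h1 : f ⟨j, ⟨c, hj⟩⟩ < f ⟨i, ⟨c + 1, hi⟩⟩ := by
      rcases (hT _ _).1 hlt with h | h
      · exact h
      · have := readingKey_lt_iff.1 h.2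
        simp at this
    obtain ⟨h, hle⟩ := ht i j c hj hi hij h1
    refine ⟨h, ((hT _ _).2 ?_).le⟩
    rcases hle.lt_or_eq with h2 | h2
    · exact Or.inl h2
    · exact Or.inr ⟨h2, readingKey_lt_iff.2 (Or.inr ⟨rfl, by simpa using hij⟩)⟩
  · rcases (hT (T.symm ⟨t, by omega⟩) (T.symm ⟨t + 1, h⟩)).1 (by simp) with h2 | h2
    · exact h2
    · have := readingKey_lt_iff.1 h2.2
      omega
  · ext x
    simp

open scoped Classical in
-- The weight fixes the weakly increasing relabelling as `i ∘ β.index`, so SSYRT of this weight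
-- correspond to the standard `T` compatible with it.
theorem coeff_exponent_youngRowStrictSchur (β : Composition n) (i : Fin β.length ↪o Fin k) :
    coeff (exponent β i) (youngRowStrictSchur k α) =
      ((Finset.univ.filter fun T : Cell α ≃ Fin n =>
        IsSSYRT (k := n) T ∧ colSteps T ⊆ blockSteps β).card : ℤ) := by
  rw [coeff_youngRowStrictSchur]
  congr 1
  symm
  have hw : Monotone (i ∘ β.index) := i.monotone.comp (index_monotone β)
  refine Finset.card_bij (fun T _ => (i ∘ β.index) ∘ T) ?_ ?_ ?_
  · intro T hT
    simp only [Finset.mem_filter, Finset.mem_univ, true_and] at hT ⊢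
    refine ⟨hT.1.comp hw fun t h hc => i.lt_iff_lt.2 (colSteps_subset_iff.1 hT.2 t h hc), ?_⟩
    rw [weight_comp_equiv, weight_index]
  · intro T hT T' hT' he
    simp only [Finset.mem_filter, Finset.mem_univ, true_and] at hT hT'
    refine equiv_eq_of_lt_imp_lt fun x y hxy => ?_
    have h1 := standardKey_lt_of_lt hT.1 hw
      (fun t h hc => i.lt_iff_lt.2 (colSteps_subset_iff.1 hT.2 t h hc)) hxy
    by_contra! h2
    rcases h2.lt_or_eq with h2 | h2
    · have h3 := standardKey_lt_of_lt hT'.1 hw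
        (fun t h hc => i.lt_iff_lt.2 (colSteps_subset_iff.1 hT'.2 t h hc)) h2
      rw [← he] at h3
      exact lt_asymm h1 h3
    · rw [T'.injective h2] at hxy
      exact lt_irrefl _ hxy
  · intro f hf
    simp only [Finset.mem_filter, Finset.mem_univ, true_and] at hf
    obtain ⟨T, w, hT, hwm, hD, hwT⟩ := hf.1.exists_standardization
    have hwi : w = i ∘ β.index := monotone_eq_of_weight_eq hwm hw <| by
      rw [weight_index, ← hf.2, ← hwT, weight_comp_equiv]
    subst hwi
    refine ⟨T, ?_, hwT⟩
    simp only [Finset.mem_filter, Finset.mem_univ, true_and]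
    exact ⟨hT, colSteps_subset_iff.2 fun t h hc => i.lt_iff_lt.1 (hD t h hc)⟩

/-! ### The row-by-row tableau and its column steps -/

theorem blocksFinEquiv_lt_of_row_lt {x y : Cell α} (h : x.1 < y.1) :
    α.blocksFinEquiv x < α.blocksFinEquiv y := by
  change α.sizeUpTo x.1 + x.2 < α.sizeUpTo y.1 + y.2
  have h1 := α.sizeUpTo_succ' x.1
  have h2 := α.monotone_sizeUpTo (Nat.succ_le_of_lt (Fin.lt_def.1 h))
  have h3 := x.2.2
  simp only [Nat.succ_eq_add_one] at h2
  omega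

theorem blocksFinEquiv_lt_of_col_lt {i : Fin α.length} {c d : Fin (α.blocksFun i)} (h : c < d) :
    α.blocksFinEquiv ⟨i, c⟩ < α.blocksFinEquiv ⟨i, d⟩ := by
  change α.sizeUpTo i + c < α.sizeUpTo i + d
  have : (c : ℕ) < d := h
  omega

theorem isSSYRT_blocksFinEquiv : IsSSYRT (k := n) α.blocksFinEquiv :=
  isSSYRT_iff.2 ⟨fun _ _ _ h => blocksFinEquiv_lt_of_col_lt h,
    fun _ _ _ _ h => (blocksFinEquiv_lt_of_row_lt h).le,
    fun _ _ _ _ _ h hlt => absurd hlt (blocksFinEquiv_lt_of_row_lt h).not_gt⟩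

theorem colSteps_blocksFinEquiv (γ : Composition n) :
    colSteps γ.blocksFinEquiv =
      (Finset.univ.filter fun t : Fin n => (t : ℕ) + 1 < n) \ blockSteps γ := by
  ext ⟨t, ht⟩
  simp only [Finset.mem_sdiff, Finset.mem_filter, Finset.mem_univ, true_and]
  by_cases h : t + 1 < n
  · rw [mem_colSteps h, mem_blockSteps h]
    simp only [h, true_and]
    have := blocksFinEquiv_symm_succ γ t h
    change (γ.index _ = γ.index _ ∧ _) ∨ ((γ.index _ : ℕ) = γ.index _ + 1 ∧ _) at this
    rw [Fin.ext_iff] at this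
    rw [Fin.lt_def]
    omega
  · simp [colSteps, h]

theorem blockSteps_subset (γ : Composition n) :
    blockSteps γ ⊆ Finset.univ.filter fun t : Fin n => (t : ℕ) + 1 < n := by
  intro t ht
  simp only [blockSteps, Finset.mem_filter, Finset.mem_univ, true_and] at ht ⊢
  exact ht.1

theorem colSteps_subset (T : Cell α ≃ Fin n) :
    colSteps T ⊆ Finset.univ.filter fun t : Fin n => (t : ℕ) + 1 < n := by
  intro t ht
  simp only [colSteps, Finset.mem_filter, Finset.mem_univ, true_and] at ht ⊢
  exact ht.1

/-- By counting: `blockSteps` is injective, and there are `2 ^ (n - 1)` compositions, at least as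
many as subsets of `L`. -/
theorem exists_blockSteps_eq {S : Finset (Fin n)}
    (hS : S ⊆ Finset.univ.filter fun t : Fin n => (t : ℕ) + 1 < n) :
    ∃ γ : Composition n, blockSteps γ = S := by
  set L := Finset.univ.filter fun t : Fin n => (t : ℕ) + 1 < n with hL
  have hc : L.card ≤ n - 1 := by
    rw [← Finset.card_range (n - 1)]
    refine Finset.card_le_card_of_injOn Fin.val (fun t ht => ?_) Fin.val_injective.injOn
    simp only [hL, Finset.coe_filter, Finset.mem_univ, true_and, Set.mem_ofPred_eq] at ht
    simp only [Finset.coe_range, Set.mem_Iio]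
    omega
  have h := Finset.eq_of_subset_of_card_le
    (s := Finset.univ.image (blockSteps (n := n))) (t := L.powerset)
    (by
      intro S hS
      obtain ⟨γ, -, rfl⟩ := Finset.mem_image.1 hS
      exact Finset.mem_powerset.2 (blockSteps_subset γ))
    (by
      rw [Finset.card_powerset, Finset.card_image_of_injective _ blockSteps_injective,
        Finset.card_univ, composition_card]
      exact Nat.pow_le_pow_right (by norm_num) hc)
  have hm : S ∈ Finset.univ.image (blockSteps (n := n)) := h ▸ Finset.mem_powerset.2 hS
  obtain ⟨γ, -, hγ⟩ := Finset.mem_image.1 hm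
  exact ⟨γ, hγ⟩

theorem colSteps_blocksFinEquiv_injective :
    Function.Injective fun γ : Composition n => colSteps γ.blocksFinEquiv := by
  intro β γ h
  simp only [colSteps_blocksFinEquiv] at h
  refine blockSteps_injective ?_
  rw [← Finset.sdiff_sdiff_eq_self (blockSteps_subset β), h,
    Finset.sdiff_sdiff_eq_self (blockSteps_subset γ)]

theorem exists_colSteps_eq (T : Cell α ≃ Fin n) :
    ∃ γ : Composition n, colSteps T = colSteps γ.blocksFinEquiv := by
  obtain ⟨γ, hγ⟩ := exists_blockSteps_eq
    (S := (Finset.univ.filter fun t : Fin n => (t : ℕ) + 1 < n) \ colSteps T) Finset.sdiff_subset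
  exact ⟨γ, by rw [colSteps_blocksFinEquiv, hγ, Finset.sdiff_sdiff_eq_self (colSteps_subset T)]⟩

/-! ### Triangularity with respect to column sums -/

/-- The sum of the column indices of all cells. -/
def colSum (α : Composition n) : ℕ :=
  ∑ x : Cell α, (x.2 : ℕ)

theorem sum_col_symm (T : Cell α ≃ Fin n) : ∑ t, ((T.symm t).2 : ℕ) = colSum α :=
  T.symm.sum_comp fun x : Cell α => (x.2 : ℕ)

/-- At a common step the column rises by exactly one in the filling of `γ` and by at least one in
`T`; elsewhere the former returns to column `0`. -/
theorem col_le_of_colSteps_eq {γ : Composition n} {T : Cell α ≃ Fin n}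
    (h : colSteps T = colSteps γ.blocksFinEquiv) (t : Fin n) :
    ((γ.blocksFinEquiv.symm t).2 : ℕ) ≤ (T.symm t).2 := by
  obtain ⟨t, ht⟩ := t
  induction t with
  | zero => exact (blocksFinEquiv_symm_zero γ ht).2.trans_le (Nat.zero_le _)
  | succ t ih =>
    have ih := ih (by omega)
    have h1 := blocksFinEquiv_symm_succ γ t ht
    have h2 := Finset.ext_iff.1 h ⟨t, by omega⟩
    rw [mem_colSteps ht, mem_colSteps ht] at h2
    simp only at h1
    omega

/-- A standard tableau that places each run of column steps in the columns `0, 1, 2, …` is filled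
row by row. -/
theorem eq_blocksFinEquiv {T : Cell α ≃ Fin n} (hT : IsSSYRT (k := n) T)
    (h0 : ∀ h : 0 < n, ((T.symm ⟨0, h⟩).2 : ℕ) = 0)
    (hs : ∀ (t : ℕ) (h : t + 1 < n), ((T.symm ⟨t + 1, h⟩).2 : ℕ) ≠ 0 →
      ((T.symm ⟨t + 1, h⟩).2 : ℕ) = (T.symm ⟨t, by omega⟩).2 + 1) :
    T = α.blocksFinEquiv := by
  obtain ⟨-, hf, ht⟩ := isSSYRT_iff.1 hT
  -- Every row consists of consecutive numbers. If `u + 1` sits in `(i, c + 1)`, then `u` sits in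
  -- column `c` of some row `j`, and `j = i` has to be shown.
  have key : ∀ (c : ℕ) (i : Fin α.length) (h : c < α.blocksFun i),
      (T ⟨i, ⟨c, h⟩⟩ : ℕ) = T ⟨i, ⟨0, α.one_le_blocksFun i⟩⟩ + c := by
    intro c
    induction c with
    | zero => intro i h; rfl
    | succ c ih =>
      intro i h
      have hci : c < α.blocksFun i := by omega
      have hlt : T ⟨i, ⟨c, hci⟩⟩ < T ⟨i, ⟨c + 1, h⟩⟩ := hT.lt_of_col_lt rfl (Nat.lt_succ_self c)
      obtain ⟨⟨s, hsn⟩, hTs⟩ : ∃ s, T ⟨i, ⟨c + 1, h⟩⟩ = s := ⟨_, rfl⟩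
      have hsym : T.symm ⟨s, hsn⟩ = ⟨i, ⟨c + 1, h⟩⟩ := by rw [← hTs, Equiv.symm_apply_apply]
      cases s with
      | zero =>
        have := h0 hsn
        rw [hsym] at this
        simp at this
      | succ u =>
        have h1 := hs u hsn
        rw [hsym] at h1
        obtain ⟨⟨j, ⟨d, hd⟩⟩, hz⟩ : ∃ z, z = T.symm ⟨u, by omega⟩ := ⟨_, rfl⟩
        rw [← hz] at h1
        have hdc : c = d := by simpa using h1 (by simp)
        subst hdc
        have hTz : T ⟨j, ⟨c, hd⟩⟩ = ⟨u, by omega⟩ := by rw [hz, Equiv.apply_symm_apply]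
        have hu : (T ⟨j, ⟨c, hd⟩⟩ : ℕ) = u := by rw [hTz]
        have hlt' : (T ⟨i, ⟨c, hci⟩⟩ : ℕ) < u + 1 := by rw [hTs] at hlt; exact hlt
        rcases lt_trichotomy j i with hji | rfl | hij
        -- For `j < i`, induction and the first column give `T (i, c) ≥ T (j, c) = u`, so the two
        -- cells coincide.
        · exfalso
          have h2 := ih i hci
          have h3 := ih j hd
          have h4 : (T ⟨j, ⟨0, α.one_le_blocksFun j⟩⟩ : ℕ) ≤ T ⟨i, ⟨0, α.one_le_blocksFun i⟩⟩ :=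
            hf j i _ _ hji
          have h5 : T ⟨i, ⟨c, hci⟩⟩ = T ⟨j, ⟨c, hd⟩⟩ := Fin.ext (by omega)
          have h6 := congrArg Sigma.fst (T.injective h5)
          exact hji.ne' h6
        · have := hu.symm.trans (ih j hd)
          rw [hTs]
          change u + 1 = _
          omega
        -- For `j > i`, the triple rule squeezes `T (j, c + 1)` to `u + 1`, which is already taken.
        · exfalso
          obtain ⟨h2, h3⟩ := ht i j c hd h hij (by rw [hTz, hTs]; exact Nat.lt_succ_self u)
          have h4 : T ⟨j, ⟨c, hd⟩⟩ < T ⟨j, ⟨c + 1, h2⟩⟩ :=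
            hT.lt_of_col_lt rfl (Nat.lt_succ_self c)
          rw [hTz] at h4
          have h5 : T ⟨j, ⟨c + 1, h2⟩⟩ = T ⟨i, ⟨c + 1, h⟩⟩ := by
            refine le_antisymm h3 ?_
            rw [hTs]
            exact h4
          exact hij.ne' (congrArg Sigma.fst (T.injective h5))
  symm
  refine equiv_eq_of_lt_imp_lt fun x y hxy => ?_
  rcases lt_trichotomy x.1 y.1 with h | h | h
  · obtain ⟨i, c, hc⟩ := x
    obtain ⟨j, d, hd⟩ := y
    simp only at h
    by_contra! h1
    have h1 : (T ⟨j, ⟨d, hd⟩⟩ : ℕ) ≤ T ⟨i, ⟨c, hc⟩⟩ := h1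
    have h2 := key d j hd
    have h3 := key c i hc
    have h4 : (T ⟨i, ⟨0, α.one_le_blocksFun i⟩⟩ : ℕ) ≤ T ⟨j, ⟨0, α.one_le_blocksFun j⟩⟩ :=
      hf i j _ _ h
    -- The consecutive entries of row `i` would reach the first entry of row `j`, at column `e`.
    obtain ⟨e, he⟩ := Nat.exists_eq_add_of_le h4
    have h5 := key e i (by omega)
    have h6 := congrArg Sigma.fst (T.injective (Fin.ext (h5.trans he.symm)))
    exact h.ne h6
  · refine hT.lt_of_col_lt h ?_
    obtain ⟨i, c⟩ := x
    obtain ⟨j, d⟩ := y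
    simp only at h
    subst h
    by_contra! h1
    rcases h1.lt_or_eq with h2 | h2
    · exact lt_asymm hxy (blocksFinEquiv_lt_of_col_lt h2)
    · exact hxy.ne' (congrArg _ (cell_ext rfl h2))
  · exact absurd (blocksFinEquiv_lt_of_row_lt h) (lt_asymm hxy)

/-- Equal sums make the pointwise inequality of columns an equality, so `T` inherits the column
pattern of a row-by-row filling. -/
theorem colSum_lt_or_eq {γ : Composition n} {T : Cell α ≃ Fin n} (hT : IsSSYRT (k := n) T)
    (h : colSteps T = colSteps γ.blocksFinEquiv) :
    colSum γ < colSum α ∨ (α = γ ∧ T = α.blocksFinEquiv) := by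
  rw [← sum_col_symm T, ← sum_col_symm γ.blocksFinEquiv]
  have hle := col_le_of_colSteps_eq h
  rcases (Finset.sum_le_sum fun t _ => hle t).lt_or_eq with h1 | h1
  · exact Or.inl h1
  right
  have h2 : ∀ t, ((γ.blocksFinEquiv.symm t).2 : ℕ) = (T.symm t).2 := fun t =>
    (Finset.sum_eq_sum_iff_of_le fun t _ => hle t).1 h1 t (Finset.mem_univ t)
  have h3 : T = α.blocksFinEquiv := by
    refine eq_blocksFinEquiv hT (fun hn => ?_) fun t ht hne => ?_
    · rw [← h2]
      exact (blocksFinEquiv_symm_zero γ hn).2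
    · rw [← h2] at hne
      rw [← h2, ← h2]
      have := blocksFinEquiv_symm_succ γ t ht
      simp only at this
      omega
  subst h3
  exact ⟨colSteps_blocksFinEquiv_injective h, rfl⟩

/-! ### The two transition matrices -/

/-- The rank `r` may have ties: the diagonal block of each rank is an identity matrix. -/
theorem det_eq_one_of_unitriangular {ι : Type*} [Fintype ι] [DecidableEq ι] (M : Matrix ι ι ℤ)
    (r : ι → ℕ) (hd : ∀ a, M a a = 1) (h : ∀ a b, M a b ≠ 0 → a = b ∨ r a < r b) : M.det = 1 := by
  have hB : M.BlockTriangular r := fun a b hab => by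
    by_contra hne
    rcases h a b hne with rfl | h2
    exacts [lt_irrefl _ hab, lt_asymm hab h2]
  rw [hB.det]
  refine Finset.prod_eq_one fun c _ => ?_
  have : M.toSquareBlock r c = 1 := by
    ext ⟨a, ha⟩ ⟨b, hb⟩
    rw [Matrix.toSquareBlock_def, Matrix.of_apply, Matrix.one_apply]
    split_ifs with hab
    · obtain rfl := congrArg Subtype.val hab
      exact hd a
    · by_contra hne
      rcases h a b hne with rfl | h2
      · exact hab rfl
      · exact h2.ne (ha.trans hb.symm)
  rw [this, Matrix.det_one]

open scoped Classical in
/-- The number of standard tableaux of shape `α` whose column steps are those of the filling of `γ`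
row by row. -/
noncomputable def runMatrix (n : ℕ) : Matrix (Composition n) (Composition n) ℤ := fun α γ =>
  ((Finset.univ.filter fun T : Cell α ≃ Fin n =>
    IsSSYRT (k := n) T ∧ colSteps T = colSteps γ.blocksFinEquiv).card : ℤ)

open scoped Classical in
/-- The matrix of the relation that the rows of `γ` are separated by the steps of `β`. -/
noncomputable def stepMatrix (n : ℕ) : Matrix (Composition n) (Composition n) ℤ := fun γ β =>
  if colSteps γ.blocksFinEquiv ⊆ blockSteps β then 1 else 0

theorem det_runMatrix : (runMatrix n).det = 1 := by
  classical
  rw [← Matrix.det_transpose]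
  refine det_eq_one_of_unitriangular _ colSum (fun α => ?_) fun γ α h => ?_
  · rw [Matrix.transpose_apply, runMatrix, Nat.cast_eq_one, Finset.card_eq_one]
    refine ⟨α.blocksFinEquiv, ?_⟩
    ext T
    simp only [Finset.mem_filter, Finset.mem_univ, true_and, Finset.mem_singleton]
    constructor
    · rintro ⟨hT, h⟩
      exact ((colSum_lt_or_eq hT h).resolve_left (lt_irrefl _)).2
    · rintro rfl
      exact ⟨isSSYRT_blocksFinEquiv, rfl⟩
  · rw [Matrix.transpose_apply, runMatrix, Nat.cast_ne_zero, Finset.card_ne_zero] at h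
    obtain ⟨T, hT⟩ := h
    simp only [Finset.mem_filter, Finset.mem_univ, true_and] at hT
    exact (colSum_lt_or_eq hT.1 hT.2).symm.imp (fun h => h.1.symm) id

/-- Reindexing columns by `σ`, with `blockSteps (σ γ) = colSteps γ.blocksFinEquiv`, gives the
inclusion matrix of sets, unitriangular for cardinality; only the sign of the permutation remains.
-/
theorem isUnit_det_stepMatrix : IsUnit (stepMatrix n).det := by
  classical
  choose σ hσ using fun γ : Composition n =>
    exists_blockSteps_eq (colSteps_subset γ.blocksFinEquiv)
  have hinj : Function.Injective σ := fun β γ h =>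
    colSteps_blocksFinEquiv_injective (by simp only [← hσ, h])
  let e : Equiv.Perm (Composition n) := Equiv.ofBijective σ (Finite.injective_iff_bijective.1 hinj)
  have h1 : ((stepMatrix n).submatrix id e).det = 1 := by
    refine det_eq_one_of_unitriangular _ (fun γ => (colSteps γ.blocksFinEquiv).card)
      (fun γ => ?_) fun β γ h => ?_
    · simp [stepMatrix, e, hσ]
    · simp only [stepMatrix, Matrix.submatrix_apply, e, Equiv.ofBijective_apply, hσ, id_eq, ne_eq,
        ite_eq_right_iff, one_ne_zero, imp_false, not_not] at h
      rcases h.eq_or_ssubset with h2 | h2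
      · exact Or.inl (colSteps_blocksFinEquiv_injective h2)
      · exact Or.inr (Finset.card_lt_card h2)
  rw [Matrix.det_permute'] at h1
  exact IsUnit.of_mul_eq_one _ (mul_comm _ _ |>.trans h1)

open scoped Classical in
-- The standard tableaux are sorted by the unique `γ` sharing their column steps.
theorem runMatrix_mul_stepMatrix (α β : Composition n) :
    (runMatrix n * stepMatrix n) α β =
      ((Finset.univ.filter fun T : Cell α ≃ Fin n =>
        IsSSYRT (k := n) T ∧ colSteps T ⊆ blockSteps β).card : ℤ) := by
  choose g hg using exists_colSteps_eq (α := α)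
  rw [Matrix.mul_apply,
    Finset.card_eq_sum_card_fiberwise (f := g) (t := Finset.univ) (fun _ _ => Finset.mem_univ _),
    Nat.cast_sum]
  refine Finset.sum_congr rfl fun γ _ => ?_
  have hgγ : ∀ T, g T = γ ↔ colSteps T = colSteps γ.blocksFinEquiv := fun T =>
    ⟨fun h => h ▸ hg T, fun h => colSteps_blocksFinEquiv_injective ((hg T).symm.trans h)⟩
  simp only [runMatrix, stepMatrix, mul_ite, mul_one, mul_zero, Finset.filter_filter, hgγ]
  split_ifs with h
  · congr 2
    ext T
    simp only [Finset.mem_filter, Finset.mem_univ, true_and]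
    exact ⟨fun h2 => ⟨⟨h2.1, h2.2 ▸ h⟩, h2.2⟩, fun h2 => ⟨h2.1.1, h2.2⟩⟩
  · symm
    rw [Nat.cast_eq_zero, Finset.card_eq_zero, Finset.filter_eq_empty_iff]
    rintro T - ⟨⟨-, h2⟩, h3⟩
    exact h (h3 ▸ h2)

theorem coeff_exponent_eq_matrix (α β : Composition n) (i : Fin β.length ↪o Fin k) :
    coeff (exponent β i) (youngRowStrictSchur k α) = (runMatrix n * stepMatrix n) α β := by
  rw [runMatrix_mul_stepMatrix, coeff_exponent_youngRowStrictSchur]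

/-! ### Quasisymmetry and the basis -/

theorem degree_weight {X : Type*} [Fintype X] (f : X → Fin k) :
    (weight f).degree = Fintype.card X := by
  simp [weight]

theorem degree_exponent {d : ℕ} (β : Composition d) (i : Fin β.length ↪o Fin k) :
    (exponent β i).degree = d := by
  rw [← weight_index, degree_weight, Fintype.card_fin]

theorem isHomogeneous_youngRowStrictSchur (α : Composition n) :
    (youngRowStrictSchur k α).IsHomogeneous n := by
  refine IsHomogeneous.sum _ _ _ fun T _ => ?_
  have h := IsHomogeneous.prod (Finset.univ : Finset (Cell α))
    (fun c => (X (T c) : MvPolynomial (Fin k) ℤ)) (fun _ => 1) fun c _ => isHomogeneous_X _ _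
  have hc : Fintype.card (Cell α) = n :=
    (Fintype.card_congr α.blocksFinEquiv).trans (Fintype.card_fin n)
  simpa only [Finset.sum_const, Finset.card_univ, hc, smul_eq_mul, mul_one] using h

/-- In degree `n` the coefficient formula does not involve the chosen variables; in other degrees
both coefficients vanish. -/
theorem youngRowStrictSchur_mem_QSym (α : Composition n) : youngRowStrictSchur k α ∈ QSym n k := by
  refine ⟨isHomogeneous_youngRowStrictSchur α, fun d β i j => ?_⟩
  by_cases hd : d = n
  · subst hd
    rw [coeff_exponent_eq_matrix, coeff_exponent_eq_matrix]
  · rw [(isHomogeneous_youngRowStrictSchur α).coeff_eq_zero (by rwa [degree_exponent]),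
      (isHomogeneous_youngRowStrictSchur α).coeff_eq_zero (by rwa [degree_exponent])]

theorem exists_exponent_eq (m : Fin k →₀ ℕ) (hm : m.degree = n) :
    ∃ (β : Composition n) (i : Fin β.length ↪o Fin k), exponent β i = m := by
  let e := m.support.orderEmbOfFin rfl
  have hsum : ∀ (Y : Type) [AddCommMonoid Y] (F : Fin k → Y),
      ∑ s, F (e s) = ∑ x ∈ m.support, F x := by
    intro Y _ F
    rw [← Finset.sum_coe_sort m.support]
    exact (m.support.orderIsoOfFin rfl).toEquiv.sum_comp fun x => F x
  let β : Composition n :=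
    { blocks := List.ofFn fun s => m (e s)
      blocks_pos := by
        intro b hb
        obtain ⟨s, rfl⟩ := (List.mem_ofFn' _ _).1 hb
        exact Nat.pos_of_ne_zero (Finsupp.mem_support_iff.1 (m.support.orderEmbOfFin_mem rfl s))
      blocks_sum := by
        rw [List.sum_ofFn, hsum ℕ m, ← hm]
        rfl }
  have hl : β.length = m.support.card := List.length_ofFn
  refine ⟨β, (Fin.castOrderIso hl).toOrderEmbedding.trans e, ?_⟩
  have hb : ∀ s, β.blocksFun s = m (e (Fin.cast hl s)) := fun s => by
    simp [Composition.blocksFun, β, Fin.cast]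
  rw [exponent]
  simp only [hb]
  refine ((Fin.castOrderIso hl).toEquiv.sum_comp fun s => Finsupp.single (e s) (m (e s))).trans ?_
  rw [hsum _ fun x => Finsupp.single x (m x)]
  exact m.sum_single

/-- The coefficients of a quasisymmetric polynomial at the monomials `x_1^{β_1} ⋯ x_l^{β_l}`. -/
noncomputable def quasiCoeff (hk : n ≤ k) : QSym n k →ₗ[ℤ] Composition n → ℤ :=
  LinearMap.pi fun β =>
    (lcoeff ℤ (exponent β (Fin.castLEOrderEmb (β.length_le.trans hk)))).comp (QSym n k).subtype

/-- Every exponent vector of degree `n` has the form `exponent β i`, and quasisymmetry moves `i` to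
the initial variables. -/
theorem quasiCoeff_injective (hk : n ≤ k) : Function.Injective (quasiCoeff hk) := by
  rw [injective_iff_map_eq_zero]
  rintro ⟨f, hf⟩ h
  ext m
  by_cases hm : m.degree = n
  · obtain ⟨β, i, rfl⟩ := exists_exponent_eq m hm
    have h2 := congrFun h β
    exact (hf.2 n β _ _).trans h2
  · exact hf.1.coeff_eq_zero hm

theorem exists_basis_youngRowStrictSchur (hk : n ≤ k) :
    ∃ b : Module.Basis (Composition n) ℤ (QSym n k),
      ∀ α : Composition n, (b α : MvPolynomial (Fin k) ℤ) = youngRowStrictSchur k α := by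
  classical
  let R : Composition n → QSym n k := fun α =>
    ⟨youngRowStrictSchur k α, youngRowStrictSchur_mem_QSym α⟩
  let N := runMatrix n * stepMatrix n
  have hN : IsUnit N := by
    rw [Matrix.isUnit_iff_isUnit_det, Matrix.det_mul, det_runMatrix, one_mul]
    exact isUnit_det_stepMatrix
  let Ψ : (Composition n → ℤ) →ₗ[ℤ] QSym n k := Fintype.linearCombination ℤ R
  -- In these coordinates `Ψ` is multiplication by the invertible `N`; with `quasiCoeff` injective,
  -- `Ψ` is bijective.
  have hcomp : ∀ a, quasiCoeff hk (Ψ a) = Matrix.vecMul a N := by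
    intro a
    ext β
    simp only [Ψ, Fintype.linearCombination_apply, map_sum, map_smul, Finset.sum_apply,
      Pi.smul_apply, smul_eq_mul, Matrix.vecMul, dotProduct]
    exact Finset.sum_congr rfl fun α _ => congrArg _ (coeff_exponent_eq_matrix α β _)
  have hinj : Function.Injective Ψ := fun a b hab =>
    Matrix.vecMul_injective_of_isUnit hN (by simp only [← hcomp, hab])
  have hsurj : Function.Surjective Ψ := fun f => by
    obtain ⟨a, ha⟩ := Matrix.vecMul_surjective_iff_isUnit.2 hN (quasiCoeff hk f)
    exact ⟨a, quasiCoeff_injective hk ((hcomp a).trans ha)⟩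
  refine ⟨.ofEquivFun (LinearEquiv.ofBijective Ψ ⟨hinj, hsurj⟩).symm, fun α => ?_⟩
  rw [Module.Basis.coe_ofEquivFun]
  change (Ψ (Pi.single α 1) : MvPolynomial (Fin k) ℤ) = _
  simp [Ψ, R, Fintype.linearCombination_apply_single]

end YoungRowStrict

theorem mainTheorem3 (n k : ℕ) (hk : n ≤ k) :
    ∃ b : Module.Basis (Composition n) ℤ (YoungRowStrict.QSym n k),
      ∀ α : Composition n,
        (b α : MvPolynomial (Fin k) ℤ) = YoungRowStrict.youngRowStrictSchur k α :=
  YoungRowStrict.exists_basis_youngRowStrictSchur hk
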